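/- Let $(\Omega,\mathcal F,\mu)$ be a probability space and let $T:\Omega\to\Omega$ be an invertible, bi-measurable, $\mu$-preserving and ergodic transformation. Let $c:\Omega\to(0,+\infty)$ be measurable. For $\omega\in\Omega$ and $x\in\mathbb Z$, give the unoriented edge $\{x,x+1\}$ of $\mathbb Z$ the conductance $c(x,x+1)(\omega)=c(x+1,x)(\omega):=c(T^x\omega)$, and set $\bar c(x)(\omega):=c(x-1,x)(\omega)+c(x,x+1)(\omega)$ and $\bar c:=\bar c(0)$. Let $\mathbb P_0^\omega$ be the law of the Markov chain $(S_n)_{n\ge 0}$ on $\mathbb Z$ that starts at $0$ and jumps from $x$ to $x\pm1$ with probability $c(x,x\pm1)(\omega)/\bar c(x)(\omega)$. For $r\ge 0$ let $B(0,r):=\{x\in\mathbb Z : |x|<r\}$. Suppose that $1/c$ is $\mu$-integrable. Then, for $\mu$-almost every $\omega$, the sequence $$ \left(\sqrt{2n}\,\max_{x\in B(0,\sqrt{2n})\cap 2\mathbb Z}\frac{\mathbb P_0^\omega[S_{2n}=x]}{\bar c(x)(\omega)}\right)_{n\ge 0} $$ is bounded (its term for $n=0$, where the maximum is over the empty set,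 is read as $0$). If, moreover, $\int_\Omega \bar c\,d\mu=+\infty$, then, for $\mu$-almost every $\omega$, $$ \lim_{n\to+\infty}\sqrt{2n}\,\max_{x\in B(0,\sqrt{2n})\cap 2\mathbb Z}\frac{\mathbb P_0^\omega[S_{2n}=x]}{\bar c(x)(\omega)}=0. $$ -/

import Mathlib

open MeasureTheory ProbabilityTheory Filter Topology

noncomputable section

namespace ConductanceWalk

/-! ### The walk in a fixed environment

A fixed environment is a family `a : ℤ → ]0, +∞[`, where `a x` is the conductance of the
unoriented edge `{x, x + 1}`. -/

/-- The total conductance `c̄(x) = c(x - 1, x) + c(x, x + 1)` at the vertex `x`. -/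
def vertexCond (a : ℤ → Set.Ioi (0 : ℝ)) (x : ℤ) : ℝ :=
  (a (x - 1) : ℝ) + (a x : ℝ)

lemma vertexCond_pos (a : ℤ → Set.Ioi (0 : ℝ)) (x : ℤ) : 0 < vertexCond a x :=
  add_pos (a (x - 1)).2 (a x).2

/-- The probability `p(x, x + 1) = c(x, x + 1) / c̄(x)` of a jump to the right. -/
def probRight (a : ℤ → Set.Ioi (0 : ℝ)) (x : ℤ) : ℝ := (a x : ℝ) / vertexCond a x

/-- The probability `p(x, x - 1) = c(x, x - 1) / c̄(x)` of a jump to the left. -/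
def probLeft (a : ℤ → Set.Ioi (0 : ℝ)) (x : ℤ) : ℝ := (a (x - 1) : ℝ) / vertexCond a x

/-- The transition kernel of the walk: from `x`, jump to `x + 1` with probability `p(x, x + 1)`
and to `x - 1` with probability `p(x, x - 1)`. -/
def stepKernel (a : ℤ → Set.Ioi (0 : ℝ)) : Kernel ℤ ℤ :=
  Kernel.ofFunOfCountable fun x =>
    ENNReal.ofReal (probRight a x) • Measure.dirac (x + 1) +
      ENNReal.ofReal (probLeft a x) • Measure.dirac (x - 1)

lemma stepKernel_apply (a : ℤ → Set.Ioi (0 : ℝ)) (x : ℤ) :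
    stepKernel a x = ENNReal.ofReal (probRight a x) • Measure.dirac (x + 1) +
      ENNReal.ofReal (probLeft a x) • Measure.dirac (x - 1) := rfl

instance isMarkovKernel_stepKernel (a : ℤ → Set.Ioi (0 : ℝ)) : IsMarkovKernel (stepKernel a) := by
  refine ⟨fun x => ⟨?_⟩⟩
  have h := vertexCond_pos a x
  have h1 : 0 ≤ probRight a x := (div_pos (a x).2 h).le
  have h2 : 0 ≤ probLeft a x := (div_pos (a (x - 1)).2 h).le
  have h3 : probRight a x + probLeft a x = 1 := by
    rw [probRight, probLeft, ← add_div, add_comm]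
    exact div_self h.ne'
  simp [stepKernel_apply, ← ENNReal.ofReal_add h1 h2, h3]

/-- The law of the trajectory `(S_n)_{n ≥ 0}` of the Markov chain on `ℤ` that starts at `x₀` and
has transition kernel `stepKernel a`; the process is the coordinate process on `ℕ → ℤ`. -/
def walkLaw (a : ℤ → Set.Ioi (0 : ℝ)) (x₀ : ℤ) : Measure (ℕ → ℤ) :=
  Kernel.trajMeasure (X := fun _ => ℤ) (Measure.dirac x₀) fun n =>
    (stepKernel a).comap (fun h : (i : Finset.Iic n) → ℤ => h ⟨n, Finset.mem_Iic.2 le_rfl⟩)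
      (measurable_pi_apply _)

instance isProbabilityMeasure_walkLaw (a : ℤ → Set.Ioi (0 : ℝ)) (x₀ : ℤ) :
    IsProbabilityMeasure (walkLaw a x₀) := by
  unfold walkLaw
  infer_instance

/-- The probability `ℙ_{x₀}[S_n = x]`. -/
def walkProb (a : ℤ → Set.Ioi (0 : ℝ)) (x₀ : ℤ) (n : ℕ) (x : ℤ) : ℝ :=
  (walkLaw a x₀).real {s | s n = x}

/-- The set `B(0, √(2n)) ∩ 2ℤ`, where `B(0, r) = {x ∈ ℤ : |x| < r}`. -/
def evenBall (n : ℕ) : Set ℤ :=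
  Metric.ball (0 : ℤ) (√(2 * (n : ℝ))) ∩ {x | Even x}

/-- The maximum of `ℙ_0[S_{2n} = x] / c̄(x)` over `x ∈ B(0, √(2n)) ∩ 2ℤ`. For `n ≥ 1` this is a
genuine maximum (`isGreatest_maxRatio`); for `n = 0` the set is empty and the value is `0`. -/
def maxRatio (a : ℤ → Set.Ioi (0 : ℝ)) (n : ℕ) : ℝ :=
  sSup ((fun x : ℤ => walkProb a 0 (2 * n) x / vertexCond a x) '' evenBall n)

lemma isGreatest_maxRatio (a : ℤ → Set.Ioi (0 : ℝ)) {n : ℕ} (hn : 1 ≤ n) :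
    IsGreatest ((fun x : ℤ => walkProb a 0 (2 * n) x / vertexCond a x) '' evenBall n)
      (maxRatio a n) := by
  have hne : (evenBall n).Nonempty := by
    refine ⟨0, Metric.mem_ball_self (Real.sqrt_pos.2 ?_), Even.zero⟩
    have : (1 : ℝ) ≤ n := by exact_mod_cast hn
    linarith
  have hfin : (evenBall n).Finite :=
    ((isCompact_closedBall (0 : ℤ) (√(2 * (n : ℝ)))).finite_of_discrete).subset
      fun x hx => Metric.ball_subset_closedBall hx.1
  exact ⟨(hne.image _).csSup_mem (hfin.image _),
    fun y hy => le_csSup (hfin.image _).bddAbove hy⟩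

/-! ### The stationary random environment -/

/-- The environment at `ω`: the edge `{x, x + 1}` has conductance `c (T ^ x ω)`, `x ∈ ℤ`. -/
def environment {Ω : Type*} [MeasurableSpace Ω] (T : Ω ≃ᵐ Ω) (c : Ω → Set.Ioi (0 : ℝ)) (ω : Ω) :
    ℤ → Set.Ioi (0 : ℝ) :=
  fun x => c (((T.toEquiv : Equiv.Perm Ω) ^ x) ω)

end ConductanceWalk

end

/-!
In a fixed environment the walk is reversible with respect to `c̄`, so its heat kernel
`q_n(x) = ℙ_0[S_n = x] / c̄(x)` evolves by `q_{n+1} = P q_n`, where the transition operator `P` is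
symmetric on `ℓ²(ℤ, c̄)`, and `⟨q_m, q_n⟩ = q_{m+n}(0)` (`condInner_heatKernel`). Hence
`k ↦ q_{2k}(0)` is convex and nonnegative, and the energy `⟨g, (1 - P²) g⟩` of `g = q_{2n}` is at
most `q_{2n}(0) / n` (`mul_energy_heatKernel_le`). This energy is that of two one-dimensional
networks, on the even and on the odd integers, whose resistances are sums of consecutive `1 / c`
(`sum_energy_le`).

By Cauchy–Schwarz, the oscillation of `q_{2n}` over the even points of `[-2N, 2N]` is at most
`√(R_N q_{2n}(0) / n)`, where `R_N` is the resistance of the box. As `∑ q_{2n}(x) c̄(x) ≤ 1`, some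
even point of `[0, 2N]` has `q_{2n} ≤ 1 / V_N`, where `V_N` is the conductance of `[0, 2N]`. Thus
`q_{2n} ≤ 1 / V_N + √(R_N q_{2n}(0) / n)` on these points (`heatKernel_le`). Suppose `R_N ≤ K N`;
then `V_N ≥ N / K` by the harmonic–arithmetic mean inequality. With `N` of order `√n`, the bound at
`x = 0` reads `w ≤ C + √(C w)` for `w = √n q_{2n}(0)`, so `w` is bounded, and then so is
`√n q_{2n}` on the ball. If moreover `V_N / N → ∞`, then `N` of order `t √n` gives
`limsup w ≤ 2 K t` for every `t > 0`, so `w → 0`, and the maximum follows.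

The environment satisfies these bounds almost surely: if `∫ f < 0`, the Birkhoff sums of `f` under
an ergodic map are almost surely bounded above (`Ergodic.ae_bddAbove_birkhoffSum`, from the maximal
ergodic theorem). Applied to `1 / c - l` with `l > ∫ 1 / c`, for `T` and for its inverse, this
gives `R_N ≤ K N`; applied to `l - min(c, M)` for each `l`, with `M` large, it gives `V_N / N → ∞`
when `∫ c = ∞`.
-/

/-! ### Birkhoff sums of a function with negative integral -/

section Ergodic

variable {Ω : Type*}

/-- The running maximum `max (0, S_1 f, …, S_n f)` of the Birkhoff sums `S_k f = birkhoffSum T f k`,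
defined through the recursion `M_{n+1} = max (0, f + M_n ∘ T)`. -/
noncomputable def birkhoffMax (T : Ω → Ω) (f : Ω → ℝ) : ℕ → Ω → ℝ
  | 0 => fun _ => 0
  | n + 1 => fun ω => max 0 (f ω + birkhoffMax T f n (T ω))

lemma birkhoffMax_nonneg (T : Ω → Ω) (f : Ω → ℝ) (n : ℕ) (ω : Ω) : 0 ≤ birkhoffMax T f n ω := by
  cases n with
  | zero => exact le_rfl
  | succ n => exact le_max_left _ _

lemma birkhoffMax_le_succ (T : Ω → Ω) (f : Ω → ℝ) (n : ℕ) (ω : Ω) :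
    birkhoffMax T f n ω ≤ birkhoffMax T f (n + 1) ω := by
  induction n generalizing ω with
  | zero => exact birkhoffMax_nonneg T f 1 ω
  | succ n ih => exact max_le_max le_rfl (by gcongr; exact ih (T ω))

lemma birkhoffMax_mono (T : Ω → Ω) (f : Ω → ℝ) (ω : Ω) : Monotone fun n => birkhoffMax T f n ω :=
  monotone_nat_of_le_succ fun n => birkhoffMax_le_succ T f n ω

lemma birkhoffSum_le_birkhoffMax (T : Ω → Ω) (f : Ω → ℝ) (n : ℕ) (ω : Ω) :
    birkhoffSum T f n ω ≤ birkhoffMax T f n ω := by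
  induction n generalizing ω with
  | zero => simp [birkhoffMax]
  | succ n ih =>
    rw [birkhoffSum_succ']
    exact le_max_of_le_right (by gcongr; exact ih (T ω))

lemma bddAbove_birkhoffMax_comp_iff (T : Ω → Ω) (f : Ω → ℝ) (ω : Ω) :
    BddAbove (Set.range fun n => birkhoffMax T f n (T ω)) ↔
      BddAbove (Set.range fun n => birkhoffMax T f n ω) := by
  constructor
  · rintro ⟨B, hB⟩
    refine ⟨max 0 (f ω + B), ?_⟩
    rintro _ ⟨n, rfl⟩
    refine (birkhoffMax_le_succ T f n ω).trans (max_le_max le_rfl ?_)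
    gcongr
    exact hB ⟨n, rfl⟩
  · rintro ⟨B, hB⟩
    refine ⟨B - f ω, ?_⟩
    rintro _ ⟨n, rfl⟩
    have h1 : birkhoffMax T f (n + 1) ω ≤ B := hB ⟨n + 1, rfl⟩
    have h2 : f ω + birkhoffMax T f n (T ω) ≤ birkhoffMax T f (n + 1) ω := le_max_right _ _
    simp only
    linarith

variable [MeasurableSpace Ω] {μ : Measure Ω} {T : Ω → Ω} {f : Ω → ℝ}

lemma measurable_birkhoffMax (hT : Measurable T) (hf : Measurable f) (n : ℕ) :
    Measurable (birkhoffMax T f n) := by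
  induction n with
  | zero => exact measurable_const
  | succ n ih => exact measurable_const.max (hf.add (ih.comp hT))

lemma integrable_birkhoffMax (hT : MeasurePreserving T μ μ) (hf : Integrable f μ) (n : ℕ) :
    Integrable (birkhoffMax T f n) μ := by
  induction n with
  | zero => exact integrable_zero _ _ _
  | succ n ih =>
    exact (integrable_zero _ _ _).sup (hf.add (hT.integrable_comp_of_integrable ih))

lemma measurableSet_bddAbove_birkhoffMax (hT : Measurable T) (hf : Measurable f) :
    MeasurableSet {ω | BddAbove (Set.range fun n => birkhoffMax T f n ω)} :=
  measurableSet_bddAbove_range fun n => measurable_birkhoffMax hT hf n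

/-- A form of the maximal ergodic theorem: if the Birkhoff sums of `f` are almost surely unbounded
above, then `∫ f ≥ 0`. Indeed `M_{n+1} - M_n ∘ T = max (-M_n ∘ T, f)` has nonnegative integral, as
`T` preserves `μ` and `M_n ≤ M_{n+1}`, and it tends to `f` as `M_n → ∞`. -/
lemma integral_nonneg_of_not_bddAbove_birkhoffMax (hT : MeasurePreserving T μ μ)
    (hf : Integrable f μ)
    (hub : ∀ᵐ ω ∂μ, ¬ BddAbove (Set.range fun n => birkhoffMax T f n ω)) :
    0 ≤ ∫ ω, f ω ∂μ := by
  have hM := integrable_birkhoffMax hT hf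
  have hMT : ∀ n, Integrable (fun ω => birkhoffMax T f n (T ω)) μ := fun n =>
    hT.integrable_comp_of_integrable (hM n)
  have hlim : Tendsto (fun n => ∫ ω, max (-birkhoffMax T f n (T ω)) (f ω) ∂μ) atTop
      (𝓝 (∫ ω, f ω ∂μ)) := by
    refine tendsto_integral_of_dominated_convergence (fun ω => |f ω|)
      (fun n => ((hMT n).neg.sup hf).aestronglyMeasurable) hf.abs
      (fun n => .of_forall fun ω => ?_) ?_
    · have h0 := birkhoffMax_nonneg T f n (T ω)
      rw [Real.norm_eq_abs, abs_le]
      exact ⟨(neg_abs_le _).trans (le_max_right _ _),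
        max_le (by linarith [abs_nonneg (f ω)]) (le_abs_self _)⟩
    · filter_upwards [hub] with ω hω
      rw [← bddAbove_birkhoffMax_comp_iff] at hω
      have htop := tendsto_atTop_atTop_of_monotone (birkhoffMax_mono T f (T ω)) fun b => by
        by_contra! h
        exact hω ⟨b, by rintro _ ⟨n, rfl⟩; exact (h n).le⟩
      refine tendsto_const_nhds.congr' ?_
      filter_upwards [htop.eventually_ge_atTop (-f ω)] with n hn
      exact (max_eq_right (by linarith)).symm
  refine ge_of_tendsto' hlim fun n => ?_
  have hpt : ∀ ω, max (-birkhoffMax T f n (T ω)) (f ω) =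
      birkhoffMax T f (n + 1) ω - birkhoffMax T f n (T ω) := fun ω => by
    rw [birkhoffMax, ← max_sub_sub_right]
    simp
  simp_rw [hpt]
  rw [integral_sub (hM _) (hMT n)]
  have hinv : ∫ ω, birkhoffMax T f n (T ω) ∂μ = ∫ ω, birkhoffMax T f n ω ∂μ := by
    rw [← integral_map hT.aemeasurable (by rw [hT.map_eq]; exact (hM n).aestronglyMeasurable),
      hT.map_eq]
  rw [hinv, sub_nonneg]
  exact integral_mono (hM _) (hM _) (birkhoffMax_le_succ T f n)

/-- If `T` is ergodic and `∫ f < 0`, then almost surely the Birkhoff sums of `f` are bounded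
above. This one-sided consequence of the pointwise ergodic theorem follows from the maximal ergodic
theorem, the event being invariant. -/
theorem Ergodic.ae_bddAbove_birkhoffSum (hT : Ergodic T μ) (hfm : Measurable f)
    (hf : Integrable f μ) (hneg : ∫ ω, f ω ∂μ < 0) :
    ∀ᵐ ω ∂μ, ∃ B : ℝ, 0 ≤ B ∧ ∀ n, birkhoffSum T f n ω ≤ B := by
  have hset := measurableSet_bddAbove_birkhoffMax hT.measurable hfm
  have hinv : T ⁻¹' {ω | BddAbove (Set.range fun n => birkhoffMax T f n ω)} =
      {ω | BddAbove (Set.range fun n => birkhoffMax T f n ω)} :=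
    Set.ext fun ω => bddAbove_birkhoffMax_comp_iff T f ω
  rcases hT.toPreErgodic.ae_mem_or_ae_notMem hset hinv with h | h
  · filter_upwards [h] with ω ⟨B, hB⟩
    exact ⟨B, (birkhoffMax_nonneg T f 0 ω).trans (hB ⟨0, rfl⟩),
      fun n => (birkhoffSum_le_birkhoffMax T f n ω).trans (hB ⟨n, rfl⟩)⟩
  · exact absurd (integral_nonneg_of_not_bddAbove_birkhoffMax hT.toMeasurePreserving hf h)
      hneg.not_ge

variable [IsProbabilityMeasure μ]

/-- The Birkhoff sums of an integrable function grow at most linearly. -/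
theorem Ergodic.ae_birkhoffSum_le_mul (hT : Ergodic T μ) (hfm : Measurable f)
    (hf : Integrable f μ) :
    ∀ᵐ ω ∂μ, ∃ K : ℝ, ∀ n : ℕ, birkhoffSum T f n ω ≤ K * n := by
  set l : ℝ := ∫ ω, f ω ∂μ + 1 with hl
  have h := hT.ae_bddAbove_birkhoffSum (f := fun ω => f ω - l) (hfm.sub_const l)
    (hf.sub (integrable_const l))
    (by rw [integral_sub hf (integrable_const l)]; simp [hl])
  filter_upwards [h] with ω ⟨B, hB0, hB⟩
  refine ⟨B + l, fun n => ?_⟩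
  rcases Nat.eq_zero_or_pos n with rfl | hn
  · simp
  have hn' : (1 : ℝ) ≤ n := by exact_mod_cast hn
  have h2 := hB n
  have h3 : birkhoffSum T (fun ω => f ω - l) n ω = birkhoffSum T f n ω - n * l := by
    simp [birkhoffSum]
  nlinarith

/-- The Birkhoff sums of a nonnegative function with infinite integral grow faster than any
linear function. -/
theorem Ergodic.ae_mul_le_birkhoffSum (hT : Ergodic T μ) (hfm : Measurable f) (hf0 : ∀ ω, 0 ≤ f ω)
    (hf : ∫⁻ ω, ENNReal.ofReal (f ω) ∂μ = ⊤) :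
    ∀ᵐ ω ∂μ, ∀ κ : ℕ, ∀ᶠ n : ℕ in atTop, κ * (n : ℝ) ≤ birkhoffSum T f n ω := by
  rw [ae_all_iff]
  intro κ
  -- A truncation of `f` has integral larger than `κ + 1`.
  obtain ⟨M, hM⟩ : ∃ M : ℕ, ((κ + 1 : ℕ) : ENNReal) <
      ∫⁻ ω, ENNReal.ofReal (min (f ω) M) ∂μ := by
    have hlim : Tendsto (fun M : ℕ => ∫⁻ ω, ENNReal.ofReal (min (f ω) M) ∂μ) atTop
        (𝓝 (∫⁻ ω, ENNReal.ofReal (f ω) ∂μ)) := by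
      refine lintegral_tendsto_of_tendsto_of_monotone
        (fun M => (hfm.min measurable_const).ennreal_ofReal.aemeasurable)
        (.of_forall fun ω M M' h => ENNReal.ofReal_le_ofReal (by gcongr))
        (.of_forall fun ω => tendsto_const_nhds.congr' ?_)
      filter_upwards [eventually_ge_atTop ⌈f ω⌉₊] with M hM
      rw [min_eq_left ((Nat.le_ceil _).trans (by exact_mod_cast hM))]
    rw [hf] at hlim
    exact (hlim.eventually (lt_mem_nhds (ENNReal.natCast_lt_top _))).exists
  have hgm : Measurable fun ω => min (f ω) (M : ℝ) := hfm.min measurable_const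
  have hg0 : ∀ ω, 0 ≤ min (f ω) (M : ℝ) := fun ω => le_min (hf0 ω) (Nat.cast_nonneg M)
  have hg : Integrable (fun ω => min (f ω) (M : ℝ)) μ :=
    Integrable.of_bound hgm.aestronglyMeasurable (M : ℝ) (.of_forall fun ω => by
      rw [Real.norm_eq_abs, abs_of_nonneg (hg0 ω)]; exact min_le_right _ _)
  have hgI : ((κ + 1 : ℕ) : ℝ) < ∫ ω, min (f ω) (M : ℝ) ∂μ := by
    rw [← ofReal_integral_eq_lintegral_ofReal hg (.of_forall hg0)] at hM
    rw [← ENNReal.ofReal_natCast] at hM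
    exact (ENNReal.ofReal_lt_ofReal_iff_of_nonneg (Nat.cast_nonneg _)).1 hM
  have h := hT.ae_bddAbove_birkhoffSum (f := fun ω => ((κ + 1 : ℕ) : ℝ) - min (f ω) M)
    (measurable_const.sub hgm) ((integrable_const _).sub hg)
    (by rw [integral_sub (integrable_const _) hg]; simpa using hgI)
  filter_upwards [h] with ω ⟨B, hB0, hB⟩
  filter_upwards [eventually_ge_atTop ⌈B⌉₊] with n hn
  have hn' : B ≤ n := (Nat.le_ceil _).trans (by exact_mod_cast hn)
  have h2 := hB n
  have h3 : birkhoffSum T (fun ω => ((κ + 1 : ℕ) : ℝ) - min (f ω) M) n ω =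
      n * ((κ + 1 : ℕ) : ℝ) - birkhoffSum T (fun ω => min (f ω) (M : ℝ)) n ω := by
    simp [birkhoffSum]
    ring
  have h4 : birkhoffSum T (fun ω => min (f ω) (M : ℝ)) n ω ≤ birkhoffSum T f n ω :=
    Finset.sum_le_sum fun k _ => min_le_left _ _
  push_cast at h3
  push_cast at h2
  linarith

end Ergodic

namespace ConductanceWalk

/-! ### Marginals of the walk -/

lemma walkProb_zero (a : ℤ → Set.Ioi (0 : ℝ)) (x₀ x : ℤ) :
    walkProb a x₀ 0 x = if x = x₀ then 1 else 0 := by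
  have h : (walkLaw a x₀).map (Preorder.frestrictLe (π := fun _ => ℤ) 0) =
      (Measure.dirac x₀).map
        (MeasurableEquiv.piUnique (fun _ : Finset.Iic 0 => ℤ)).symm := by
    rw [walkLaw, Kernel.trajMeasure, Measure.map_comp _ _ (by fun_prop),
      Kernel.traj_map_frestrictLe, Kernel.partialTraj_self, Measure.id_comp]
  have h2 : {s : ℕ → ℤ | s 0 = x} = Preorder.frestrictLe (π := fun _ => ℤ) 0 ⁻¹'
      {h | h ⟨0, Finset.mem_Iic.2 le_rfl⟩ = x} := rfl
  have hm : MeasurableSet {h : (i : Finset.Iic 0) → ℤ | h ⟨0, Finset.mem_Iic.2 le_rfl⟩ = x} :=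
    (by fun_prop : Measurable fun h : (i : Finset.Iic 0) → ℤ =>
      h ⟨0, Finset.mem_Iic.2 le_rfl⟩) (measurableSet_singleton x)
  rw [walkProb, Measure.real, h2, ← Measure.map_apply (by fun_prop) hm, h,
    Measure.map_apply (by fun_prop) hm, Measure.dirac_apply]
  by_cases hx : x = x₀
  · subst hx
    simp [Set.indicator, MeasurableEquiv.piUnique]
  · have hx' : ¬ x₀ = x := fun h => hx h.symm
    simp [Set.indicator, MeasurableEquiv.piUnique, hx, hx']

lemma probRight_nonneg (a : ℤ → Set.Ioi (0 : ℝ)) (x : ℤ) : 0 ≤ probRight a x :=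
  (div_pos (a x).2 (vertexCond_pos a x)).le

lemma probLeft_nonneg (a : ℤ → Set.Ioi (0 : ℝ)) (x : ℤ) : 0 ≤ probLeft a x :=
  (div_pos (a (x - 1)).2 (vertexCond_pos a x)).le

/-- The one-step (Chapman–Kolmogorov) recursion for the marginals of the walk. -/
lemma walkProb_succ (a : ℤ → Set.Ioi (0 : ℝ)) (x₀ : ℤ) (n : ℕ) (x : ℤ) :
    walkProb a x₀ (n + 1) x =
      probRight a (x - 1) * walkProb a x₀ n (x - 1) +
        probLeft a (x + 1) * walkProb a x₀ n (x + 1) := by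
  set ν := walkLaw a x₀ with hν
  have hmeas : ∀ (k : ℕ) (y : ℤ), MeasurableSet {s : ℕ → ℤ | s k = y} := fun k y =>
    (by fun_prop : Measurable fun s : ℕ → ℤ => s k) (measurableSet_singleton y)
  have hstep := Kernel.map_frestrictLe_trajMeasure_compProd_eq_map_trajMeasure
    (X := fun _ => ℤ) (μ₀ := Measure.dirac x₀) (κ := fun n =>
    (stepKernel a).comap (fun h : (i : Finset.Iic n) → ℤ => h ⟨n, Finset.mem_Iic.2 le_rfl⟩)
      (measurable_pi_apply _)) (a := n)
  change (ν.map (Preorder.frestrictLe n)).compProd _ = ν.map _ at hstep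
  have hB : MeasurableSet {q : ((i : Finset.Iic n) → ℤ) × ℤ | q.2 = x} :=
    measurable_snd (measurableSet_singleton x)
  have h := congrArg (fun m => m {q : ((i : Finset.Iic n) → ℤ) × ℤ | q.2 = x}) hstep
  rw [Measure.compProd_apply hB, Measure.map_apply (by fun_prop) hB,
    lintegral_map (Kernel.measurable_kernel_prodMk_left hB) (by fun_prop)] at h
  have hpt : ∀ s : ℕ → ℤ, stepKernel a (s n) {x} =
      {s : ℕ → ℤ | s n = x - 1}.indicator (fun _ => ENNReal.ofReal (probRight a (x - 1))) s +
      {s : ℕ → ℤ | s n = x + 1}.indicator (fun _ => ENNReal.ofReal (probLeft a (x + 1))) s := by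
    intro s
    rw [stepKernel_apply]
    by_cases h1 : s n = x - 1
    · simp [h1, Set.indicator, show x - 1 - 1 ≠ x by omega, show x - 1 ≠ x + 1 by omega]
    · by_cases h2 : s n = x + 1
      · simp [h2, Set.indicator, show x + 1 + 1 ≠ x by omega, show x + 1 ≠ x - 1 by omega]
      · simp [h1, h2, Set.indicator, show s n + 1 ≠ x by omega, show s n - 1 ≠ x by omega]
  have h' : ν {s | s (n + 1) = x} =
      ENNReal.ofReal (probRight a (x - 1)) * ν {s | s n = x - 1} +
        ENNReal.ofReal (probLeft a (x + 1)) * ν {s | s n = x + 1} := by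
    calc ν {s | s (n + 1) = x} = ∫⁻ s, stepKernel a (s n) {x} ∂ν := h.symm
      _ = _ := by
        simp_rw [hpt]
        rw [lintegral_add_left (measurable_const.indicator (hmeas _ _)),
          lintegral_indicator_const (hmeas _ _), lintegral_indicator_const (hmeas _ _)]
  rw [walkProb, walkProb, walkProb, ← hν, Measure.real, h', ENNReal.toReal_add, ENNReal.toReal_mul,
    ENNReal.toReal_mul, ENNReal.toReal_ofReal (probRight_nonneg a _),
    ENNReal.toReal_ofReal (probLeft_nonneg a _)]
  · rfl
  · exact ENNReal.mul_ne_top ENNReal.ofReal_ne_top (measure_ne_top _ _)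
  · exact ENNReal.mul_ne_top ENNReal.ofReal_ne_top (measure_ne_top _ _)

lemma sum_walkProb_le_one (a : ℤ → Set.Ioi (0 : ℝ)) (x₀ : ℤ) (n : ℕ) (s : Finset ℤ) :
    ∑ x ∈ s, walkProb a x₀ n x ≤ 1 := by
  have hpre : ∀ x : ℤ, {t : ℕ → ℤ | t n = x} = (fun t : ℕ → ℤ => t n) ⁻¹' {x} := fun _ => rfl
  simp_rw [walkProb, hpre]
  rw [sum_measureReal_preimage_singleton s
    fun y _ => measurable_pi_apply n (measurableSet_singleton y)]
  exact measureReal_le_one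

/-! ### The averaging operator and the energy identity -/

/-- The transition operator `P f (x) = p(x, x + 1) f (x + 1) + p(x, x - 1) f (x - 1)`. -/
noncomputable def transOp (a : ℤ → Set.Ioi (0 : ℝ)) (f : ℤ → ℝ) (x : ℤ) : ℝ :=
  ((a x : ℝ) * f (x + 1) + (a (x - 1) : ℝ) * f (x - 1)) / vertexCond a x

/-- The inner product of `ℓ²(ℤ, c̄)`. It is only used for finitely supported functions, for which
the sum is finite. -/
noncomputable def condInner (a : ℤ → Set.Ioi (0 : ℝ)) (f g : ℤ → ℝ) : ℝ :=
  ∑' x, vertexCond a x * (f x * g x)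

variable {a : ℤ → Set.Ioi (0 : ℝ)} {f g : ℤ → ℝ}

lemma summable_of_finite_support_of_imp {F : ℤ → ℝ} (hg : (Function.support g).Finite)
    (h : ∀ x, g x = 0 → F x = 0) : Summable F :=
  summable_of_hasFiniteSupport (hg.subset fun x hx hgx => hx (h x hgx))

lemma finite_support_shift (hg : (Function.support g).Finite) (k : ℤ) :
    (Function.support fun x => g (x + k)).Finite :=
  hg.preimage (f := fun x => x + k) ((add_left_injective k).injOn)

lemma finite_support_transOp (hg : (Function.support g).Finite) :
    (Function.support (transOp a g)).Finite := by
  refine ((finite_support_shift hg 1).union (finite_support_shift hg (-1))).subset fun x hx => ?_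
  by_contra h
  simp only [Set.mem_union, Function.mem_support, not_or, not_not, ← sub_eq_add_neg] at h
  exact hx (by simp [transOp, h.1, h.2])

lemma tsum_shift (F : ℤ → ℝ) : ∑' x, F (x - 1) = ∑' x, F x :=
  (Equiv.subRight (1 : ℤ)).tsum_eq F

lemma tsum_shift' (F : ℤ → ℝ) : ∑' x, F (x + 1) = ∑' x, F x :=
  (Equiv.addRight (1 : ℤ)).tsum_eq F

lemma condInner_comm (f g : ℤ → ℝ) : condInner a f g = condInner a g f := by
  simp_rw [condInner, mul_comm (f _)]

lemma condInner_transOp_left (hg : (Function.support g).Finite) :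
    condInner a (transOp a f) g =
      ∑' x, (a x : ℝ) * (f (x + 1) * g x) + ∑' x, (a x : ℝ) * (g (x + 1) * f x) := by
  have h : ∀ x, vertexCond a x * (transOp a f x * g x) =
      (a x : ℝ) * (f (x + 1) * g x) + (a (x - 1) : ℝ) * (g (x - 1 + 1) * f (x - 1)) := fun x => by
    have := (vertexCond_pos a x).ne'
    rw [transOp, sub_add_cancel]
    field_simp
  simp_rw [condInner, h]
  rw [Summable.tsum_add (summable_of_finite_support_of_imp hg fun x hx => by simp [hx])
    (summable_of_finite_support_of_imp hg fun x hx => by simp [hx]),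
    tsum_shift fun x => (a x : ℝ) * (g (x + 1) * f x)]

/-- The transition operator is symmetric on `ℓ²(ℤ, c̄)`: the walk is reversible. -/
lemma condInner_transOp_comm (hf : (Function.support f).Finite)
    (hg : (Function.support g).Finite) :
    condInner a (transOp a f) g = condInner a f (transOp a g) := by
  rw [condInner_comm f, condInner_transOp_left hg, condInner_transOp_left hf, add_comm]

lemma two_mul_condInner_le (hf : (Function.support f).Finite)
    (hg : (Function.support g).Finite) :
    2 * condInner a f g ≤ condInner a f f + condInner a g g := by
  have h : ∀ {u v : ℤ → ℝ}, (Function.support u).Finite →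
      Summable fun x => vertexCond a x * (u x * v x) := fun hu =>
    summable_of_finite_support_of_imp hu fun x hx => by simp [hx]
  rw [condInner, condInner, condInner, ← tsum_mul_left, ← (h hf).tsum_add (h hg)]
  refine ((h hf).mul_left 2).tsum_le_tsum (fun x => ?_) ((h hf).add (h hg))
  nlinarith [mul_nonneg (vertexCond_pos a x).le (sq_nonneg (f x - g x))]

/-- The energy `⟨g, (1 - P²) g⟩` is that of a network on each of the two parity classes of `ℤ`, in
which `y - 1` and `y + 1` are joined by the edges `{y - 1, y}` and `{y, y + 1}` in
series; the finite set `s` collects some of these pairs. -/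
lemma sum_energy_le (hg : (Function.support g).Finite) (s : Finset ℤ) :
    ∑ y ∈ s, (g (y + 1) - g (y - 1)) ^ 2 / (1 / (a (y - 1) : ℝ) + 1 / (a y : ℝ)) ≤
      condInner a g g - condInner a (transOp a g) (transOp a g) := by
  have hg1 := finite_support_shift hg 1
  have hg2 := finite_support_shift hg (-1)
  have hPg := finite_support_transOp (a := a) hg
  have hs1 : Summable fun y => (a y : ℝ) * g (y + 1) ^ 2 :=
    summable_of_finite_support_of_imp hg1 fun x hx => by simp [hx]
  have hs2 : Summable fun y => (a (y - 1) : ℝ) * g (y - 1) ^ 2 :=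
    summable_of_finite_support_of_imp hg2 fun x hx => by simp [sub_eq_add_neg, hx]
  have hs3 : Summable fun y => vertexCond a y * (transOp a g y * transOp a g y) :=
    summable_of_finite_support_of_imp hPg fun x hx => by simp [hx]
  have hs4 : Summable fun y => (a y : ℝ) * g y ^ 2 :=
    summable_of_finite_support_of_imp hg fun x hx => by simp [hx]
  have hs5 : Summable fun y => (a (y - 1) : ℝ) * g y ^ 2 :=
    summable_of_finite_support_of_imp hg fun x hx => by simp [hx]
  have hnorm : condInner a g g =
      ∑' y, ((a y : ℝ) * g (y + 1) ^ 2 + (a (y - 1) : ℝ) * g (y - 1) ^ 2) := by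
    have h : ∀ x, vertexCond a x * (g x * g x) =
        (a x : ℝ) * g x ^ 2 + (a (x - 1) : ℝ) * g x ^ 2 := fun x => by rw [vertexCond]; ring
    have h5 := tsum_shift' fun x => (a (x - 1) : ℝ) * g x ^ 2
    simp only [add_sub_cancel_right] at h5
    simp_rw [condInner, h]
    rw [hs4.tsum_add hs5, hs1.tsum_add hs2, tsum_shift fun x => (a x : ℝ) * g x ^ 2, h5, add_comm]
  have hpt : ∀ y, (g (y + 1) - g (y - 1)) ^ 2 / (1 / (a (y - 1) : ℝ) + 1 / (a y : ℝ)) =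
      (a y : ℝ) * g (y + 1) ^ 2 + (a (y - 1) : ℝ) * g (y - 1) ^ 2 -
        vertexCond a y * (transOp a g y * transOp a g y) := fun y => by
    have h1 : (0 : ℝ) < a y := (a y).2
    have h2 : (0 : ℝ) < a (y - 1) := (a (y - 1)).2
    have h3 : (a (y - 1) : ℝ) + a y ≠ 0 := by positivity
    have h4 : (a y : ℝ) + a (y - 1) ≠ 0 := by positivity
    rw [transOp, vertexCond]
    field_simp
    ring
  rw [hnorm, condInner, ← (hs1.add hs2).tsum_sub hs3]
  simp_rw [← hpt]
  refine Summable.sum_le_tsum s (fun y _ => ?_) ?_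
  · have h1 : (0 : ℝ) < a y := (a y).2
    have h2 : (0 : ℝ) < a (y - 1) := (a (y - 1)).2
    positivity
  · simp_rw [hpt]
    exact (hs1.add hs2).sub hs3

/-! ### The heat kernel -/

/-- The heat kernel `ℙ_0[S_n = x] / c̄(x)`. -/
noncomputable def heatKernel (a : ℤ → Set.Ioi (0 : ℝ)) (n : ℕ) (x : ℤ) : ℝ :=
  walkProb a 0 n x / vertexCond a x

lemma heatKernel_nonneg (a : ℤ → Set.Ioi (0 : ℝ)) (n : ℕ) (x : ℤ) : 0 ≤ heatKernel a n x :=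
  div_nonneg measureReal_nonneg (vertexCond_pos a x).le

lemma heatKernel_succ (a : ℤ → Set.Ioi (0 : ℝ)) (n : ℕ) :
    heatKernel a (n + 1) = transOp a (heatKernel a n) := by
  ext x
  rw [heatKernel, transOp, walkProb_succ, probRight, probLeft, heatKernel, heatKernel,
    add_sub_cancel_right]
  congr 1
  ring

lemma finite_support_heatKernel (a : ℤ → Set.Ioi (0 : ℝ)) (n : ℕ) :
    (Function.support (heatKernel a n)).Finite := by
  induction n with
  | zero =>
    refine (Set.finite_singleton (0 : ℤ)).subset fun x hx => ?_
    by_contra h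
    exact hx (by simp [heatKernel, walkProb_zero, show x ≠ 0 from h])
  | succ n ih => rw [heatKernel_succ]; exact finite_support_transOp ih

lemma condInner_heatKernel (a : ℤ → Set.Ioi (0 : ℝ)) (m n : ℕ) :
    condInner a (heatKernel a m) (heatKernel a n) = heatKernel a (m + n) 0 := by
  induction m generalizing n with
  | zero =>
    have h0 := (vertexCond_pos a 0).ne'
    rw [condInner, tsum_eq_single 0 fun x hx => by simp [heatKernel, walkProb_zero, hx],
      heatKernel, walkProb_zero, zero_add]
    simp only [if_true]
    field_simp
  | succ m ih =>
    rw [heatKernel_succ, condInner_transOp_comm (finite_support_heatKernel a m)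
      (finite_support_heatKernel a n), ← heatKernel_succ, ih]
    congr 1
    omega

lemma antitone_heatKernel_sub (a : ℤ → Set.Ioi (0 : ℝ)) :
    Antitone fun k : ℕ => heatKernel a (2 * k) 0 - heatKernel a (2 * (k + 1)) 0 := by
  refine antitone_nat_of_succ_le fun k => ?_
  have h := two_mul_condInner_le (a := a) (finite_support_heatKernel a k)
    (finite_support_heatKernel a (k + 2))
  simp_rw [condInner_heatKernel] at h
  rw [show k + (k + 2) = 2 * (k + 1) by ring, show k + k = 2 * k by ring,
    show k + 2 + (k + 2) = 2 * (k + 1 + 1) by ring] at h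
  linarith

/-- The energy of the heat kernel at time `2n` is at most `ℙ_0[S_{2n} = 0] / (n c̄(0))`: the
on-diagonal heat kernel at even times is convex and nonnegative. -/
lemma mul_energy_heatKernel_le (a : ℤ → Set.Ioi (0 : ℝ)) (n : ℕ) :
    n * (condInner a (heatKernel a (2 * n)) (heatKernel a (2 * n)) -
      condInner a (transOp a (heatKernel a (2 * n))) (transOp a (heatKernel a (2 * n)))) ≤
      heatKernel a (2 * n) 0 := by
  rw [← heatKernel_succ, condInner_heatKernel, condInner_heatKernel]
  have hsum := Finset.sum_range_sub' (fun k => heatKernel a (2 * (n + k)) 0) n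
  have hle : n • (heatKernel a (2 * (2 * n)) 0 - heatKernel a (2 * (2 * n + 1)) 0) ≤
      ∑ k ∈ Finset.range n,
        (heatKernel a (2 * (n + k)) 0 - heatKernel a (2 * (n + (k + 1))) 0) := by
    rw [← Finset.card_range n, ← Finset.sum_const]
    simp only [Finset.card_range]
    refine Finset.sum_le_sum fun k hk => ?_
    have := antitone_heatKernel_sub a (show n + k ≤ 2 * n by have := Finset.mem_range.1 hk; omega)
    exact this
  rw [hsum, nsmul_eq_mul, add_zero] at hle
  rw [show 2 * n + 2 * n = 2 * (2 * n) by ring,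
    show 2 * n + 1 + (2 * n + 1) = 2 * (2 * n + 1) by ring]
  linarith [heatKernel_nonneg a (2 * (n + n)) 0]

/-! ### Volume, resistance and pointwise bounds on the heat kernel -/

/-- The total conductance of the edges between `0` and `2N`, which bounds from below the total mass
`∑ c̄(2j)` of the even vertices of `[0, 2N]`. -/
noncomputable def boxVolume (a : ℤ → Set.Ioi (0 : ℝ)) (N : ℕ) : ℝ :=
  ∑ k ∈ Finset.range (2 * N), (a k : ℝ)

/-- The sum of the resistances of the edges `{y, y + 1}` with `|y| ≤ 2N`. -/
noncomputable def boxResistance (a : ℤ → Set.Ioi (0 : ℝ)) (N : ℕ) : ℝ :=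
  ∑ y ∈ Finset.Icc (-(2 * N : ℤ)) (2 * N), 1 / (a y : ℝ)

lemma one_div_cond_pos (a : ℤ → Set.Ioi (0 : ℝ)) (y : ℤ) : 0 < 1 / (a y : ℝ) :=
  one_div_pos.2 (a y).2

lemma resistance_nonneg (a : ℤ → Set.Ioi (0 : ℝ)) (N : ℕ) : 0 ≤ boxResistance a N :=
  Finset.sum_nonneg fun y _ => (one_div_cond_pos a y).le

lemma volume_pos (a : ℤ → Set.Ioi (0 : ℝ)) {N : ℕ} (hN : 1 ≤ N) : 0 < boxVolume a N :=
  Finset.sum_pos (fun k _ => (a k).2) ⟨0, Finset.mem_range.2 (by omega)⟩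

lemma sum_comp_le_sum_of_injective {F : ℤ → ℝ} (hF : ∀ y, 0 ≤ F y) {e : ℕ → ℤ}
    (he : Function.Injective e) {m : ℕ} {s : Finset ℤ} (hs : ∀ k < m, e k ∈ s) :
    ∑ k ∈ Finset.range m, F (e k) ≤ ∑ y ∈ s, F y := by
  rw [← Finset.sum_image (f := F) (g := e) fun _ _ _ _ h => he h]
  refine Finset.sum_le_sum_of_subset_of_nonneg (fun y hy => ?_) fun y _ _ => hF y
  obtain ⟨k, hk, rfl⟩ := Finset.mem_image.1 hy
  exact hs k (Finset.mem_range.1 hk)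

lemma sum_resistance_even_le (a : ℤ → Set.Ioi (0 : ℝ)) {N m : ℕ} {i : ℤ} (hi : -(N : ℤ) ≤ i)
    (him : i + m ≤ N) :
    ∑ k ∈ Finset.range m,
      (1 / (a (2 * (i + k) + 1 - 1) : ℝ) + 1 / (a (2 * (i + k) + 1) : ℝ)) ≤ boxResistance a N := by
  have h : ∀ m : ℕ, ∑ k ∈ Finset.range m,
      (1 / (a (2 * (i + k) + 1 - 1) : ℝ) + 1 / (a (2 * (i + k) + 1) : ℝ)) =
      ∑ l ∈ Finset.range (2 * m), 1 / (a (2 * i + l) : ℝ) := by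
    intro m
    induction m with
    | zero => simp
    | succ m ih =>
      rw [Finset.sum_range_succ, ih, Nat.mul_succ, Finset.sum_range_succ,
        Finset.sum_range_succ, add_assoc]
      push_cast
      rw [show 2 * (i + m) + 1 - 1 = 2 * i + 2 * (m : ℤ) by ring,
        show 2 * (i + m) + 1 = 2 * i + (2 * (m : ℤ) + 1) by ring]
  rw [h]
  refine sum_comp_le_sum_of_injective (F := fun y => 1 / (a y : ℝ))
    (fun y => (one_div_cond_pos a y).le) (e := fun l : ℕ => 2 * i + l)
    (fun k l hkl => by simpa using hkl) fun k hk => ?_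
  rw [Finset.mem_Icc]
  omega

/-- The energy controls the oscillation of a function on the even points of `[-2N, 2N]`, by the
Cauchy–Schwarz inequality along the path that joins two of them. -/
lemma sq_sub_le_resistance_mul_energy {g : ℤ → ℝ} (hg : (Function.support g).Finite) {N : ℕ}
    {i j : ℤ} (hi : -(N : ℤ) ≤ i) (hij : i ≤ j) (hj : j ≤ N) :
    (g (2 * j) - g (2 * i)) ^ 2 ≤ boxResistance a N *
      (condInner a g g - condInner a (transOp a g) (transOp a g)) := by
  obtain ⟨m, rfl⟩ : ∃ m : ℕ, j = i + m := ⟨(j - i).toNat, by omega⟩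
  set y : ℕ → ℤ := fun k => 2 * (i + k) + 1 with hy
  have hyinj : Function.Injective y := fun k l hkl => by simp [hy] at hkl; omega
  have hr : ∀ z, 0 < 1 / (a (z - 1) : ℝ) + 1 / (a z : ℝ) := fun z =>
    add_pos (one_div_cond_pos a _) (one_div_cond_pos a _)
  have htel : g (2 * (i + m)) - g (2 * i) =
      ∑ k ∈ Finset.range m, (g (y k + 1) - g (y k - 1)) := by
    have h := Finset.sum_range_sub (fun k : ℕ => g (2 * (i + k))) m
    simp only [Nat.cast_zero, add_zero] at h
    rw [← h]
    refine Finset.sum_congr rfl fun k _ => ?_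
    simp only [hy]
    push_cast
    congr 2 <;> ring
  have hE : ∑ k ∈ Finset.range m, (g (y k + 1) - g (y k - 1)) ^ 2 /
      (1 / (a (y k - 1) : ℝ) + 1 / (a (y k) : ℝ)) ≤
      condInner a g g - condInner a (transOp a g) (transOp a g) := by
    have h := sum_energy_le (a := a) hg ((Finset.range m).image y)
    rwa [Finset.sum_image fun _ _ _ _ h => hyinj h] at h
  have hE0 : 0 ≤ ∑ k ∈ Finset.range m, (g (y k + 1) - g (y k - 1)) ^ 2 /
      (1 / (a (y k - 1) : ℝ) + 1 / (a (y k) : ℝ)) :=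
    Finset.sum_nonneg fun k _ => div_nonneg (sq_nonneg _) (hr _).le
  rw [htel]
  calc _ ≤ (∑ k ∈ Finset.range m, (1 / (a (y k - 1) : ℝ) + 1 / (a (y k) : ℝ))) *
        ∑ k ∈ Finset.range m, (g (y k + 1) - g (y k - 1)) ^ 2 /
          (1 / (a (y k - 1) : ℝ) + 1 / (a (y k) : ℝ)) :=
        Finset.sum_sq_le_sum_mul_sum_of_sq_le_mul _ (fun k _ => (hr _).le)
          (fun k _ => div_nonneg (sq_nonneg _) (hr _).le)
          fun k _ => by rw [mul_div_cancel₀ _ (hr _).ne']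
    _ ≤ _ := mul_le_mul (sum_resistance_even_le a hi hj) hE hE0 (resistance_nonneg a N)

lemma volume_add_le_sum_vertexCond (a : ℤ → Set.Ioi (0 : ℝ)) (N : ℕ) :
    boxVolume a N + a (2 * N) ≤ ∑ j ∈ Finset.range (N + 1), vertexCond a (2 * j) := by
  induction N with
  | zero => simp [boxVolume, vertexCond, (show (0 : ℝ) < a (-1) from (a (-1)).2).le]
  | succ N ih =>
    rw [Finset.sum_range_succ, boxVolume, mul_add, mul_one, Finset.sum_range_succ,
      Finset.sum_range_succ, vertexCond]
    rw [boxVolume] at ih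
    push_cast
    rw [show 2 * ((N : ℤ) + 1) - 1 = 2 * N + 1 by ring]
    linarith

/-- As the walk has total mass one, the heat kernel is small at some even vertex. -/
lemma exists_heatKernel_le (a : ℤ → Set.Ioi (0 : ℝ)) (n : ℕ) {N : ℕ} (hN : 1 ≤ N) :
    ∃ j : ℤ, 0 ≤ j ∧ j ≤ N ∧ heatKernel a n (2 * j) ≤ 1 / boxVolume a N := by
  by_contra! h
  have hV := volume_pos a hN
  have hle : ∑ j ∈ Finset.range (N + 1), walkProb a 0 n (2 * j) ≤ 1 := by
    have h1 := sum_walkProb_le_one a 0 n ((Finset.range (N + 1)).image fun j : ℕ => 2 * (j : ℤ))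
    rwa [Finset.sum_image fun k _ l _ hkl => by simpa using hkl] at h1
  have hlt : ∑ j ∈ Finset.range (N + 1), vertexCond a (2 * j) * (1 / boxVolume a N) <
      ∑ j ∈ Finset.range (N + 1), walkProb a 0 n (2 * j) := by
    refine Finset.sum_lt_sum_of_nonempty ⟨0, by simp⟩ fun j hj => ?_
    have hj' := h j (by omega) (by have := Finset.mem_range.1 hj; omega)
    rwa [heatKernel, lt_div_iff₀ (vertexCond_pos a _), mul_comm] at hj'
  rw [← Finset.sum_mul] at hlt
  have h2 := volume_add_le_sum_vertexCond a N
  have h3 : (0 : ℝ) < a (2 * N) := (a (2 * N)).2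
  have h4 : boxVolume a N * (1 / boxVolume a N) ≤
      (∑ j ∈ Finset.range (N + 1), vertexCond a (2 * j)) * (1 / boxVolume a N) := by
    gcongr
    linarith
  rw [mul_one_div_cancel hV.ne'] at h4
  linarith

/-- The basic pointwise estimate: a volume term and an oscillation term. -/
lemma heatKernel_le (a : ℤ → Set.Ioi (0 : ℝ)) {n N : ℕ} (hn : 1 ≤ n) (hN : 1 ≤ N) {i : ℤ}
    (hi : |i| ≤ N) :
    heatKernel a (2 * n) (2 * i) ≤
      1 / boxVolume a N + √(boxResistance a N * (heatKernel a (2 * n) 0 / n)) := by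
  obtain ⟨j, hj0, hjN, hj⟩ := exists_heatKernel_le a (2 * n) hN
  rw [abs_le] at hi
  have hg := finite_support_heatKernel a (2 * n)
  have hn' : (0 : ℝ) < n := by exact_mod_cast hn
  have hsq : (heatKernel a (2 * n) (2 * i) - heatKernel a (2 * n) (2 * j)) ^ 2 ≤
      boxResistance a N * (heatKernel a (2 * n) 0 / n) := by
    have hE := mul_energy_heatKernel_le a n
    rw [mul_comm, ← le_div_iff₀ hn'] at hE
    refine le_trans ?_ (mul_le_mul_of_nonneg_left hE (resistance_nonneg a N))
    rcases le_total i j with hij | hij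
    · rw [← neg_sub, neg_sq]
      exact sq_sub_le_resistance_mul_energy hg hi.1 hij hjN
    · exact sq_sub_le_resistance_mul_energy hg (by omega) hij hi.2
  have := Real.le_sqrt_of_sq_le hsq
  linarith

/-- The basic estimate in the diffusive scaling, for boxes of size at most `ρ √n`. -/
lemma sqrt_mul_heatKernel_le {K ρ : ℝ} {n N : ℕ} (hR : boxResistance a N ≤ K * N) (hK : 0 ≤ K)
    (hn : 1 ≤ n) (hN : 1 ≤ N) (hNn : N ≤ ρ * √n) {i : ℤ} (hi : |i| ≤ N) :
    √n * heatKernel a (2 * n) (2 * i) ≤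
      √n / boxVolume a N + √(K * ρ * (√n * heatKernel a (2 * n) 0)) := by
  have hn' : (0 : ℝ) < n := by exact_mod_cast hn
  have hu := heatKernel_nonneg a (2 * n) 0
  have h := mul_le_mul_of_nonneg_left (heatKernel_le a hn hN hi) (Real.sqrt_nonneg (n : ℝ))
  rw [mul_add, mul_one_div, ← Real.sqrt_mul hn'.le] at h
  refine h.trans (add_le_add le_rfl (Real.sqrt_le_sqrt ?_))
  calc (n : ℝ) * (boxResistance a N * (heatKernel a (2 * n) 0 / n))
      = boxResistance a N * heatKernel a (2 * n) 0 := by field_simp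
    _ ≤ K * (ρ * √n) * heatKernel a (2 * n) 0 := by
        gcongr
        exact hR.trans (by gcongr)
    _ = _ := by ring

/-- At `x = 0` the estimate bounds `w = √n ℙ_0[S_{2n} = 0] / c̄(0)` in terms of `√w`, hence
bounds `w` itself. -/
lemma sqrt_mul_heatKernel_zero_le {K ρ : ℝ} {n N : ℕ} (hR : boxResistance a N ≤ K * N) (hK : 0 ≤ K)
    (hn : 1 ≤ n) (hN : 1 ≤ N) (hρ : 0 ≤ ρ) (hNn : N ≤ ρ * √n) :
    √n * heatKernel a (2 * n) 0 ≤ 2 * (√n / boxVolume a N) + K * ρ := by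
  have h := sqrt_mul_heatKernel_le hR hK hn hN hNn (i := 0) (by simp)
  rw [mul_zero] at h
  have hw : 0 ≤ √(n : ℝ) * heatKernel a (2 * n) 0 :=
    mul_nonneg (Real.sqrt_nonneg _) (heatKernel_nonneg a _ _)
  have hKρ : 0 ≤ K * ρ := mul_nonneg hK hρ
  have hamgm : √(K * ρ * (√n * heatKernel a (2 * n) 0)) ≤
      (K * ρ + √n * heatKernel a (2 * n) 0) / 2 := by
    refine Real.sqrt_le_iff.2 ⟨by positivity, ?_⟩
    nlinarith [sq_nonneg (K * ρ - √n * heatKernel a (2 * n) 0)]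
  linarith

/-- The harmonic–arithmetic mean inequality turns an upper bound on the resistance into a lower
bound on the volume. -/
lemma le_mul_volume {K : ℝ} {N : ℕ} (hR : boxResistance a N ≤ K * N) (hN : 1 ≤ N) :
    N ≤ K * boxVolume a N := by
  have hV := volume_pos a hN
  have hN' : (1 : ℝ) ≤ N := by exact_mod_cast hN
  have hcs : (∑ _k ∈ Finset.range (2 * N), (1 : ℝ)) ^ 2 ≤
      boxVolume a N * ∑ k ∈ Finset.range (2 * N), 1 / (a k : ℝ) :=
    Finset.sum_sq_le_sum_mul_sum_of_sq_le_mul _ (fun k _ => (a k).2.le)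
      (fun k _ => (one_div_cond_pos a k).le) fun k _ => by
        rw [mul_one_div_cancel (a k).2.ne', one_pow]
  have hle : ∑ k ∈ Finset.range (2 * N), 1 / (a k : ℝ) ≤ boxResistance a N :=
    sum_comp_le_sum_of_injective (F := fun y => 1 / (a y : ℝ))
      (fun y => (one_div_cond_pos a y).le) (e := fun l : ℕ => (l : ℤ)) Nat.cast_injective
      fun k hk => by rw [Finset.mem_Icc]; omega
  have h := hcs.trans (mul_le_mul_of_nonneg_left (hle.trans hR) hV.le)
  simp only [Finset.sum_const, Finset.card_range, nsmul_eq_mul, mul_one] at h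
  push_cast at h
  have h2 : (4 * N : ℝ) * N ≤ (K * boxVolume a N) * N := by nlinarith
  have := le_of_mul_le_mul_right h2 (by linarith)
  linarith

/-! ### The maximum over the even ball -/

lemma maxRatio_nonneg (a : ℤ → Set.Ioi (0 : ℝ)) (n : ℕ) : 0 ≤ maxRatio a n :=
  Real.sSup_nonneg fun _ ⟨x, _, hx⟩ => hx ▸ heatKernel_nonneg a (2 * n) x

/-- The box `|x| ≤ 2⌈√n⌉` contains the ball of radius `√(2n)`. -/
lemma sqrt_mul_maxRatio_le {K : ℝ} {n : ℕ} (hR : ∀ N : ℕ, 1 ≤ N → boxResistance a N ≤ K * N)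
    (hK : 0 ≤ K) (hn : 1 ≤ n) :
    √n * maxRatio a n ≤
      √n / boxVolume a ⌈√(n : ℝ)⌉₊ + √(K * 2 * (√n * heatKernel a (2 * n) 0)) := by
  have hn' : (1 : ℝ) ≤ n := by exact_mod_cast hn
  have hs : 1 ≤ √(n : ℝ) := Real.one_le_sqrt.2 hn'
  obtain ⟨⟨x, ⟨hxb, i, hi⟩, hx⟩, -⟩ := isGreatest_maxRatio a hn
  have hx' : maxRatio a n = heatKernel a (2 * n) (2 * i) := by
    rw [← hx, two_mul i, ← hi]
    rfl
  have hceil : √(n : ℝ) ≤ ⌈√(n : ℝ)⌉₊ := Nat.le_ceil _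
  have hceil' : (⌈√(n : ℝ)⌉₊ : ℝ) < √n + 1 := Nat.ceil_lt_add_one (by positivity)
  have hiN : |i| ≤ ⌈√(n : ℝ)⌉₊ := by
    have h1 : |(x : ℝ)| < √(2 * (n : ℝ)) := by
      rwa [Metric.mem_ball, Int.dist_eq, Int.cast_zero, sub_zero] at hxb
    have h2 : |(x : ℝ)| = 2 * |(i : ℝ)| := by
      rw [hi, ← two_mul]; push_cast; rw [abs_mul, abs_two]
    have h3 : √(2 * (n : ℝ)) ≤ 2 * √n := by
      rw [Real.sqrt_le_iff]
      exact ⟨by positivity, by rw [mul_pow, Real.sq_sqrt (by positivity)]; linarith⟩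
    have h4 : |(i : ℝ)| ≤ (⌈√(n : ℝ)⌉₊ : ℝ) := by linarith
    exact_mod_cast h4
  have hN1 : 1 ≤ ⌈√(n : ℝ)⌉₊ := Nat.one_le_ceil_iff.2 (by linarith)
  rw [hx']
  exact sqrt_mul_heatKernel_le (hR _ hN1) hK hn hN1 (by linarith) hiN

/-- In an environment whose resistances grow at most linearly, the rescaled maxima are bounded. -/
theorem isBounded_range_sqrt_mul_maxRatio {K : ℝ}
    (hR : ∀ N : ℕ, 1 ≤ N → boxResistance a N ≤ K * N) (hK : 0 ≤ K) :
    Bornology.IsBounded (Set.range fun n : ℕ => √(2 * (n : ℝ)) * maxRatio a n) := by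
  refine isBounded_iff_forall_norm_le.2 ⟨√2 * (K + √(K * 2 * (4 * K))), ?_⟩
  rintro _ ⟨n, rfl⟩
  have h0 : 0 ≤ √(2 * (n : ℝ)) * maxRatio a n :=
    mul_nonneg (Real.sqrt_nonneg _) (maxRatio_nonneg a n)
  simp only
  rw [Real.norm_eq_abs, abs_of_nonneg h0, Real.sqrt_mul zero_le_two, mul_assoc]
  gcongr
  rcases Nat.eq_zero_or_pos n with rfl | hn
  · simp only [Nat.cast_zero, Real.sqrt_zero, zero_mul]
    positivity
  have hs : 1 ≤ √(n : ℝ) := Real.one_le_sqrt.2 (by exact_mod_cast hn)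
  have hceil : √(n : ℝ) ≤ ⌈√(n : ℝ)⌉₊ := Nat.le_ceil _
  have hceil' : (⌈√(n : ℝ)⌉₊ : ℝ) < √n + 1 := Nat.ceil_lt_add_one (by positivity)
  have hN1 : 1 ≤ ⌈√(n : ℝ)⌉₊ := Nat.one_le_ceil_iff.2 (by linarith)
  have hV : √n / boxVolume a ⌈√(n : ℝ)⌉₊ ≤ K := by
    rw [div_le_iff₀ (volume_pos a hN1)]
    exact hceil.trans (le_mul_volume (hR _ hN1) hN1)
  have hw : √n * heatKernel a (2 * n) 0 ≤ 4 * K := by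
    have := sqrt_mul_heatKernel_zero_le (ρ := 2) (hR _ hN1) hK hn hN1 zero_le_two (by linarith)
    linarith
  refine (sqrt_mul_maxRatio_le hR hK hn).trans ?_
  gcongr

lemma tendsto_sqrt_div_volume (hV : ∀ κ : ℕ, ∀ᶠ N : ℕ in atTop, κ * (N : ℝ) ≤ boxVolume a N) {t : ℝ}
    (ht : 0 < t) : Tendsto (fun n : ℕ => √n / boxVolume a ⌈t * √(n : ℝ)⌉₊) atTop (𝓝 0) := by
  have hsqrt : Tendsto (fun n : ℕ => t * √(n : ℝ)) atTop atTop :=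
    (Real.tendsto_sqrt_atTop.comp tendsto_natCast_atTop_atTop).const_mul_atTop ht
  have hceil : Tendsto (fun n : ℕ => ⌈t * √(n : ℝ)⌉₊) atTop atTop :=
    tendsto_nat_ceil_atTop.comp hsqrt
  rw [Metric.tendsto_atTop']
  intro ε hε
  obtain ⟨κ, hκ⟩ := exists_nat_gt (1 / (ε * t))
  obtain ⟨n₀, hn₀⟩ := eventually_atTop.1
    ((hceil.eventually (hV κ)).and (hsqrt.eventually_ge_atTop 1))
  refine ⟨n₀, fun n hn => ?_⟩
  obtain ⟨h1, h2⟩ := hn₀ n hn.le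
  have hVpos := volume_pos a (Nat.one_le_ceil_iff.2 (by linarith : 0 < t * √(n : ℝ)))
  rw [Real.dist_eq, sub_zero, abs_of_nonneg (by positivity), div_lt_iff₀ hVpos]
  have hspos : 0 < √(n : ℝ) := pos_of_mul_pos_right (by linarith) ht.le
  have h3 : (κ : ℝ) * (t * √n) ≤ boxVolume a ⌈t * √(n : ℝ)⌉₊ :=
    (mul_le_mul_of_nonneg_left (Nat.le_ceil _) (Nat.cast_nonneg κ)).trans h1
  rw [div_lt_iff₀ (by positivity)] at hκ
  calc √(n : ℝ) = 1 * √n := (one_mul _).symm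
    _ < κ * (ε * t) * √n := by gcongr
    _ = ε * (κ * (t * √n)) := by ring
    _ ≤ _ := by gcongr

lemma tendsto_sqrt_mul_heatKernel_zero {K : ℝ} (hR : ∀ N : ℕ, 1 ≤ N → boxResistance a N ≤ K * N)
    (hK : 0 ≤ K) (hV : ∀ κ : ℕ, ∀ᶠ N : ℕ in atTop, κ * (N : ℝ) ≤ boxVolume a N) :
    Tendsto (fun n : ℕ => √(n : ℝ) * heatKernel a (2 * n) 0) atTop (𝓝 0) := by
  rw [Metric.tendsto_atTop']
  intro ε hε
  -- Boxes of size about `t √n` contribute at most `2Kt` to the limit superior.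
  set t : ℝ := ε / (4 * (K + 1)) with ht_def
  have ht : 0 < t := by positivity
  have hKt : K * (2 * t) < ε / 2 := by
    have h : t * (4 * (K + 1)) = ε := div_mul_cancel₀ _ (by positivity)
    nlinarith
  have hsqrt : Tendsto (fun n : ℕ => t * √(n : ℝ)) atTop atTop :=
    (Real.tendsto_sqrt_atTop.comp tendsto_natCast_atTop_atTop).const_mul_atTop ht
  obtain ⟨n₀, hn₀⟩ := eventually_atTop.1
    ((((tendsto_sqrt_div_volume hV ht).eventually (gt_mem_nhds (show 0 < ε / 4 by positivity))).and
      (hsqrt.eventually_ge_atTop 1)).and (eventually_ge_atTop 1))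
  refine ⟨n₀, fun n hn => ?_⟩
  obtain ⟨⟨h1, h2⟩, hn1⟩ := hn₀ n hn.le
  have hN1 : 1 ≤ ⌈t * √(n : ℝ)⌉₊ := Nat.one_le_ceil_iff.2 (by linarith)
  have hceil' : (⌈t * √(n : ℝ)⌉₊ : ℝ) < t * √n + 1 := Nat.ceil_lt_add_one (by positivity)
  have hw := sqrt_mul_heatKernel_zero_le (ρ := 2 * t) (hR _ hN1) hK hn1 hN1 (by positivity)
    (by linarith)
  rw [Real.dist_eq, sub_zero, abs_of_nonneg
    (mul_nonneg (Real.sqrt_nonneg _) (heatKernel_nonneg a _ _))]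
  linarith

/-- If moreover the volume grows faster than linearly, the rescaled maxima tend to zero. -/
theorem tendsto_sqrt_mul_maxRatio {K : ℝ} (hR : ∀ N : ℕ, 1 ≤ N → boxResistance a N ≤ K * N)
    (hK : 0 ≤ K) (hV : ∀ κ : ℕ, ∀ᶠ N : ℕ in atTop, κ * (N : ℝ) ≤ boxVolume a N) :
    Tendsto (fun n : ℕ => √(2 * (n : ℝ)) * maxRatio a n) atTop (𝓝 0) := by
  have h1 := tendsto_sqrt_div_volume hV one_pos
  simp only [one_mul] at h1
  have h2 := ((tendsto_sqrt_mul_heatKernel_zero hR hK hV).const_mul (K * 2)).sqrt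
  have h3 := (h1.add h2).const_mul (√2)
  simp only [mul_zero, Real.sqrt_zero, add_zero] at h3
  refine squeeze_zero' (.of_forall fun n => mul_nonneg (Real.sqrt_nonneg _) (maxRatio_nonneg a n))
    ?_ h3
  filter_upwards [eventually_ge_atTop 1] with n hn
  rw [Real.sqrt_mul zero_le_two, mul_assoc]
  gcongr
  exact sqrt_mul_maxRatio_le hR hK hn

/-! ### The stationary environment -/

variable {Ω : Type*} [MeasurableSpace Ω]

lemma environment_natCast (T : Ω ≃ᵐ Ω) (c : Ω → Set.Ioi (0 : ℝ)) (ω : Ω) (k : ℕ) :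
    environment T c ω k = c (T^[k] ω) := by
  rw [environment, zpow_natCast, ← Equiv.Perm.iterate_eq_pow]
  rfl

lemma environment_neg_natCast (T : Ω ≃ᵐ Ω) (c : Ω → Set.Ioi (0 : ℝ)) (ω : Ω) (k : ℕ) :
    environment T c ω (-k) = c (T.symm^[k] ω) := by
  rw [environment, zpow_neg, zpow_natCast, ← inv_pow, ← Equiv.Perm.iterate_eq_pow]
  rfl

lemma volume_environment (T : Ω ≃ᵐ Ω) (c : Ω → Set.Ioi (0 : ℝ)) (ω : Ω) (N : ℕ) :
    boxVolume (environment T c ω) N = birkhoffSum T (fun ω => (c ω : ℝ)) (2 * N) ω := by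
  simp_rw [boxVolume, environment_natCast, birkhoffSum]

lemma resistance_environment_le (T : Ω ≃ᵐ Ω) (c : Ω → Set.Ioi (0 : ℝ)) (ω : Ω) (N : ℕ) :
    boxResistance (environment T c ω) N ≤
      birkhoffSum T (fun ω => 1 / (c ω : ℝ)) (2 * N + 1) ω +
        birkhoffSum T.symm (fun ω => 1 / (c ω : ℝ)) (2 * N + 1) ω := by
  have hpos : ∀ y, 0 ≤ 1 / (environment T c ω y : ℝ) := fun y => (one_div_cond_pos _ y).le
  have h1 : birkhoffSum T (fun ω => 1 / (c ω : ℝ)) (2 * N + 1) ω =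
      ∑ y ∈ (Finset.range (2 * N + 1)).image fun k : ℕ => (k : ℤ),
        1 / (environment T c ω y : ℝ) := by
    rw [Finset.sum_image fun k _ l _ h => by simpa using h]
    simp_rw [environment_natCast, birkhoffSum]
  have h2 : birkhoffSum T.symm (fun ω => 1 / (c ω : ℝ)) (2 * N + 1) ω =
      ∑ y ∈ (Finset.range (2 * N + 1)).image fun k : ℕ => (-k : ℤ),
        1 / (environment T c ω y : ℝ) := by
    rw [Finset.sum_image fun k _ l _ h => by simpa using h]
    simp_rw [environment_neg_natCast, birkhoffSum]
  rw [h1, h2, ← Finset.sum_union_inter, boxResistance]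
  refine le_add_of_le_of_nonneg (Finset.sum_le_sum_of_subset_of_nonneg (fun y hy => ?_)
    fun y _ _ => hpos y) (Finset.sum_nonneg fun y _ => hpos y)
  rw [Finset.mem_Icc] at hy
  simp only [Finset.mem_union, Finset.mem_image, Finset.mem_range]
  rcases le_total 0 y with h | h
  · exact .inl ⟨y.toNat, by omega, by omega⟩
  · exact .inr ⟨(-y).toNat, by omega, by omega⟩

variable {μ : Measure Ω} [IsProbabilityMeasure μ]

/-- If `1 / c` is integrable, the resistance of the environment grows at most linearly. -/
lemma ae_resistance_environment_le {T : Ω ≃ᵐ Ω} (hT : Ergodic T μ) {c : Ω → Set.Ioi (0 : ℝ)}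
    (hc : Measurable c) (hint : Integrable (fun ω => 1 / (c ω : ℝ)) μ) :
    ∀ᵐ ω ∂μ, ∃ K : ℝ, 0 ≤ K ∧
      ∀ N : ℕ, 1 ≤ N → boxResistance (environment T c ω) N ≤ K * N := by
  have hm : Measurable fun ω => 1 / (c ω : ℝ) := hc.subtype_val.const_div 1
  filter_upwards [hT.ae_birkhoffSum_le_mul hm hint, hT.symm.ae_birkhoffSum_le_mul hm hint]
    with ω ⟨K₁, h₁⟩ ⟨K₂, h₂⟩
  refine ⟨3 * (|K₁| + |K₂|), by positivity, fun N hN => ?_⟩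
  have hN' : (1 : ℝ) ≤ N := by exact_mod_cast hN
  have h1 := h₁ (2 * N + 1)
  have h2 := h₂ (2 * N + 1)
  push_cast at h1 h2
  have hK : (K₁ + K₂) * (2 * N + 1) ≤ (|K₁| + |K₂|) * (3 * N) := by
    gcongr
    · exact le_abs_self _
    · exact le_abs_self _
    · linarith
  linarith [resistance_environment_le T c ω N]

/-- If `c̄` has infinite integral, the volume of the environment grows faster than linearly. -/
lemma ae_volume_environment_ge {T : Ω ≃ᵐ Ω} (hT : Ergodic T μ) {c : Ω → Set.Ioi (0 : ℝ)}
    (hc : Measurable c)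
    (hinf : ∫⁻ ω, ENNReal.ofReal (vertexCond (environment T c ω) 0) ∂μ = ⊤) :
    ∀ᵐ ω ∂μ, ∀ κ : ℕ, ∀ᶠ N : ℕ in atTop,
      κ * (N : ℝ) ≤ boxVolume (environment T c ω) N := by
  have hm : Measurable fun ω => (c ω : ℝ) := hc.subtype_val
  -- By stationarity, the two edges at the origin contribute equally to the integral.
  have hcinf : ∫⁻ ω, ENNReal.ofReal (c ω : ℝ) ∂μ = ⊤ := by
    have hsplit : ∀ ω, ENNReal.ofReal (vertexCond (environment T c ω) 0) =
        ENNReal.ofReal (c (T.symm ω) : ℝ) + ENNReal.ofReal (c ω : ℝ) := fun ω => by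
      have h0 := environment_natCast T c ω 0
      have h1 := environment_neg_natCast T c ω 1
      simp only [Nat.cast_zero, Nat.cast_one, Function.iterate_zero, Function.iterate_one,
        id_eq] at h0 h1
      rw [vertexCond, zero_sub, h0, h1, ENNReal.ofReal_add (c (T.symm ω)).2.le (c ω).2.le]
    simp_rw [hsplit] at hinf
    rw [lintegral_add_right _ hm.ennreal_ofReal,
      hT.symm.toMeasurePreserving.lintegral_comp (f := fun ω => ENNReal.ofReal (c ω : ℝ))
        hm.ennreal_ofReal] at hinf
    simpa using hinf
  filter_upwards [hT.ae_mul_le_birkhoffSum hm (fun ω => (c ω).2.le) hcinf] with ω hω κ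
  have htwo : Tendsto (fun N : ℕ => 2 * N) atTop atTop :=
    tendsto_id.const_mul_atTop' two_pos
  filter_upwards [htwo.eventually (hω κ)] with N hN
  rw [volume_environment]
  refine le_trans ?_ hN
  push_cast
  gcongr
  linarith [(Nat.cast_nonneg N : (0 : ℝ) ≤ N)]

end ConductanceWalk

theorem mainTheorem3 {Ω : Type*} [MeasurableSpace Ω] (μ : Measure Ω) [IsProbabilityMeasure μ]
    (T : Ω ≃ᵐ Ω) (hT : Ergodic T μ) (c : Ω → Set.Ioi (0 : ℝ)) (hc : Measurable c)
    (hint : Integrable (fun ω => 1 / (c ω : ℝ)) μ) :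
    (∀ᵐ ω ∂μ, Bornology.IsBounded (Set.range fun n : ℕ =>
        √(2 * (n : ℝ)) * ConductanceWalk.maxRatio (ConductanceWalk.environment T c ω) n)) ∧
    (∫⁻ ω, ENNReal.ofReal
          (ConductanceWalk.vertexCond (ConductanceWalk.environment T c ω) 0) ∂μ = ⊤ →
      ∀ᵐ ω ∂μ, Tendsto (fun n : ℕ =>
          √(2 * (n : ℝ)) * ConductanceWalk.maxRatio (ConductanceWalk.environment T c ω) n)
        atTop (𝓝 0)) := by
  have hR := ConductanceWalk.ae_resistance_environment_le hT hc hint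
  refine ⟨?_, fun hinf => ?_⟩
  · filter_upwards [hR] with ω ⟨K, hK, hKR⟩
    exact ConductanceWalk.isBounded_range_sqrt_mul_maxRatio hKR hK
  · filter_upwards [hR, ConductanceWalk.ae_volume_environment_ge hT hc hinf] with ω ⟨K, hK, hKR⟩ hV
    exact ConductanceWalk.tendsto_sqrt_mul_maxRatio hKR hK hV
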